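/- Let $A$ be a unital $C^*$-algebra and let $\alpha\colon\mathbb{T}\to\mathrm{Aut}(A)$ be an action of the circle group, that is, a group homomorphism such that $\zeta\mapsto\alpha_\zeta(a)$ is norm continuous for every $a\in A$. Suppose that $\alpha$ has the Rokhlin property: for every $\varepsilon>0$ and every finite subset $F\subseteq A$ there is a unitary $u\in A$ such that $\|\alpha_\zeta(u)-\zeta u\|<\varepsilon$ for all $\zeta\in\mathbb{T}$ and $\|ua-au\|<\varepsilon$ for all $a\in F$. Write $A^\alpha=\{a\in A:\alpha_\zeta(a)=a\text{ for all }\zeta\in\mathbb{T}\}$ for the fixed point algebra. For an automorphism $\theta$ of $A^\alpha$, the crossed product $A^\alpha\rtimes_\theta\mathbb{Z}$ is the enveloping $C^*$-algebra of $\ell^1(\mathbb{Z},A^\alpha)$ with the operations $(a*b)(n)=\sum_{k}a(k)\,\theta^k(b(n-k))$ and $a^*(n)=\theta^n(a(-n)^*)$; it contains $A^\alpha$ (as the functions supported at $0$), and its dual action $\widehat\theta\colon\mathbb{T}\to\mathrm{Aut}(A^\alpha\rtimes_\theta\mathbb{Z})$ is determined by $\widehat\theta_\zeta(a)(n)=\zeta^n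 a(n)$. Then there exist an automorphism $\theta$ of $A^\alpha$ and an isomorphism $\varphi\colon A^\alpha\rtimes_\theta\mathbb{Z}\to A$ such that $\varphi\circ\widehat\theta_\zeta=\alpha_\zeta\circ\varphi$ for all $\zeta\in\mathbb{T}$ and $\varphi$ is the identity on $A^\alpha$. Moreover, $\theta$ is unique up to unitary equivalence: if $\theta,\theta'$ are automorphisms of $A^\alpha$ and $\varphi\colon(A^\alpha\rtimes_\theta\mathbb{Z},\widehat\theta)\to(A,\alpha)$ and $\varphi'\colon(A^\alpha\rtimes_{\theta'}\mathbb{Z},\widehat{\theta'})\to(A,\alpha)$ are equivariant isomorphisms that are the identity on $A^\alpha$, then there is a unitary $w\in A^\alpha$ such that $\theta(b)=w\,\theta'(b)\,w^*$ for all $b\in A^\alpha$. -/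

import Mathlib

/-! ## Circle actions and the Rokhlin property -/

namespace CircleAction

variable {A : Type*} [CStarAlgebra A]

/-- The fixed point algebra `A^α = {a | α_ζ(a) = a for all ζ}` of an action of the circle. -/
def fixedPoints (α : Circle →* (A ≃⋆ₐ[ℂ] A)) : StarSubalgebra ℂ A where
  carrier := {a | ∀ ζ : Circle, α ζ a = a}
  mul_mem' ha hb ζ := by rw [map_mul, ha ζ, hb ζ]
  one_mem' ζ := map_one (α ζ)
  add_mem' ha hb ζ := by rw [map_add, ha ζ, hb ζ]
  zero_mem' ζ := map_zero (α ζ)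
  algebraMap_mem' c ζ := by
    rw [Algebra.algebraMap_eq_smul_one, map_smul, map_one]
  star_mem' ha ζ := by rw [map_star, ha ζ]

theorem mem_fixedPoints {α : Circle →* (A ≃⋆ₐ[ℂ] A)} {a : A} :
    a ∈ fixedPoints α ↔ ∀ ζ : Circle, α ζ a = a := Iff.rfl

/-- Makes `fixedPoints α` a unital C⋆-algebra, through `StarSubalgebra.cstarAlgebra`. -/
instance isClosed_fixedPoints (α : Circle →* (A ≃⋆ₐ[ℂ] A)) :
    IsClosed (fixedPoints α : Set A) := by
  have h : (fixedPoints α : Set A) = ⋂ ζ : Circle, {a | α ζ a = a} := by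
    ext a; simp [mem_fixedPoints]
  rw [h]
  exact isClosed_iInter fun ζ =>
    isClosed_eq (StarAlgEquiv.isometry (α ζ)).continuous continuous_id

/-- The Rokhlin property for an action of the circle on a unital C⋆-algebra. -/
def HasRokhlinProperty (α : Circle →* (A ≃⋆ₐ[ℂ] A)) : Prop :=
  ∀ ε : ℝ, 0 < ε → ∀ F : Finset A, ∃ u ∈ unitary A,
    (∀ ζ : Circle, ‖α ζ u - (ζ : ℂ) • u‖ < ε) ∧ ∀ a ∈ F, ‖u * a - a * u‖ < ε

end CircleAction

/-! ## The crossed product of a unital C⋆-algebra by an automorphism -/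

/-- A *C⋆-seminorm* on a complex `⋆`-algebra. -/
structure IsCStarSeminorm {L : Type*} [Ring L] [StarRing L] [Module ℂ L] (p : Seminorm ℂ L) :
    Prop where
  mul_le : ∀ x y, p (x * y) ≤ p x * p y
  star_mul_self : ∀ x, p (star x * x) = p x ^ 2

theorem IsCStarSeminorm.map_star {L : Type*} [Ring L] [StarRing L] [Module ℂ L]
    {p : Seminorm ℂ L} (hp : IsCStarSeminorm p) (x : L) : p (star x) = p x := by
  have key : ∀ y, p y ≤ p (star y) := by
    intro y
    by_contra hlt
    push Not at hlt
    have h1 := hp.mul_le (star y) y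
    rw [hp.star_mul_self] at h1
    have h2 := apply_nonneg p (star y)
    nlinarith
  refine le_antisymm ?_ (key x)
  simpa using key (star x)

namespace CStarCrossedProduct

variable {B : Type*} [CStarAlgebra B]

/-- The group `ℤ` (written multiplicatively), acting on `B` through the powers of `θ`. -/
def IntAct (_θ : B ≃⋆ₐ[ℂ] B) : Type := Multiplicative ℤ

variable (θ : B ≃⋆ₐ[ℂ] B)

noncomputable instance : CommGroup (IntAct θ) := inferInstanceAs (CommGroup (Multiplicative ℤ))

/-- The integer `n` as an element of the acting group. -/
def IntAct.of (n : ℤ) : IntAct θ := Multiplicative.ofAdd n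

variable {θ} in
/-- The integer underlying an element of the acting group. -/
def IntAct.toInt (n : IntAct θ) : ℤ := Multiplicative.toAdd n

noncomputable instance : MulSemiringAction (IntAct θ) B where
  smul n b := (θ ^ n.toInt) b
  one_smul b := by
    change (θ ^ (0 : ℤ)) b = b
    simp
  mul_smul m n b := by
    change (θ ^ (m.toInt + n.toInt)) b = (θ ^ m.toInt) ((θ ^ n.toInt) b)
    rw [zpow_add]; rfl
  smul_zero n := map_zero (θ ^ n.toInt)
  smul_add n := map_add (θ ^ n.toInt)
  smul_one n := map_one (θ ^ n.toInt)
  smul_mul n := map_mul (θ ^ n.toInt)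

variable {θ} in
theorem IntAct.smul_def (n : IntAct θ) (b : B) : n • b = (θ ^ n.toInt) b := rfl

/-- The algebra `C_c(ℤ, B, θ)` of finitely supported functions `ℤ → B`, with the twisted
convolution `(a * b)(n) = ∑ k, a(k) θ^k(b(n - k))`. -/
abbrev ConvAlg : Type _ := SkewMonoidAlgebra B (IntAct θ)

namespace ConvAlg

open SkewMonoidAlgebra

variable {θ}

theorem ext_add {M : Type*} [AddCommMonoid M] {f g : ConvAlg θ →+ M}
    (h : ∀ n b, f (single n b) = g (single n b)) (x : ConvAlg θ) : f x = g x :=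
  DFunLike.congr_fun (SkewMonoidAlgebra.addHom_ext h) x

/-- The underlying additive map of the involution: `b δ_n ↦ θ^{-n}(b⋆) δ_{-n}`. -/
noncomputable def starAdd : ConvAlg θ →+ ConvAlg θ where
  toFun x := x.sum fun n b => single n⁻¹ (n⁻¹ • star b)
  map_zero' := by simp
  map_add' x y := SkewMonoidAlgebra.sum_add_index' (by simp)
    (by intro n b c; rw [star_add, smul_add, single_add])

theorem starAdd_single (n : IntAct θ) (b : B) :
    starAdd (single n b) = single n⁻¹ (n⁻¹ • star b) := by
  change (single n b).sum (fun n b => single n⁻¹ (n⁻¹ • star b)) = _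
  rw [SkewMonoidAlgebra.sum_single_index (by simp)]

/-- The involution of `C_c(ℤ, B, θ)`, `a⋆(n) = θ^n(a(-n)⋆)`. -/
noncomputable instance : Star (ConvAlg θ) := ⟨fun x => starAdd x⟩

theorem star_single (n : IntAct θ) (b : B) :
    star (single n b : ConvAlg θ) = single n⁻¹ (n⁻¹ • star b) := starAdd_single n b

theorem star_smul_coeff (n : IntAct θ) (b : B) : star (n • b) = n • star b :=
  (map_star (θ ^ n.toInt) b).symm

theorem single_mul_single' (m n : IntAct θ) (a b : B) :
    (single m a : ConvAlg θ) * single n b = single (m * n) (a * m • b) :=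
  SkewMonoidAlgebra.single_mul_single

noncomputable instance : StarRing (ConvAlg θ) where
  star_involutive x := by
    refine ext_add (f := starAdd.comp starAdd) (g := AddMonoidHom.id _) (fun n b => ?_) x
    simp [starAdd_single, star_smul_coeff]
  star_add x y := map_add starAdd x y
  star_mul x y := by
    induction x using SkewMonoidAlgebra.induction_on' with
    | add x x' hx hx' =>
      change starAdd ((x + x') * y) = starAdd y * starAdd (x + x')
      rw [add_mul, map_add, map_add, mul_add]
      exact congrArg₂ _ hx hx'
    | single m a =>
      induction y using SkewMonoidAlgebra.induction_on' with
      | add y y' hy hy' =>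
        change starAdd (_ * (y + y')) = starAdd (y + y') * starAdd _
        rw [mul_add, map_add, map_add, add_mul]
        exact congrArg₂ _ hy hy'
      | single n b =>
        rw [single_mul_single', star_single, star_single, star_single, single_mul_single']
        simp [mul_comm, smul_smul, star_smul_coeff]

theorem smul_comm_coeff (c : ℂ) (n : IntAct θ) (b : B) : n • c • b = c • n • b :=
  map_smul (θ ^ n.toInt) c b

noncomputable instance : StarModule ℂ (ConvAlg θ) where
  star_smul c x := by
    induction x using SkewMonoidAlgebra.induction_on' with
    | add x y hx hy => rw [smul_add, star_add, star_add, hx, hy, smul_add]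
    | single n b =>
      rw [smul_single, star_single, star_single, smul_single, star_smul, smul_comm_coeff]

noncomputable instance : Algebra ℂ (ConvAlg θ) :=
  Algebra.ofModule
    (fun c x y => by
      induction x using SkewMonoidAlgebra.induction_on' with
      | add x x' hx hx' => rw [smul_add, add_mul, hx, hx', add_mul, smul_add]
      | single m a =>
        induction y using SkewMonoidAlgebra.induction_on' with
        | add y y' hy hy' => rw [mul_add, hy, hy', mul_add, smul_add]
        | single n b =>
          rw [smul_single, single_mul_single', single_mul_single', smul_single, smul_mul_assoc])
    (fun c x y => by
      induction x using SkewMonoidAlgebra.induction_on' with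
      | add x x' hx hx' => rw [add_mul, hx, hx', add_mul, smul_add]
      | single m a =>
        induction y using SkewMonoidAlgebra.induction_on' with
        | add y y' hy hy' => rw [smul_add, mul_add, hy, hy', mul_add, smul_add]
        | single n b =>
          rw [smul_single, single_mul_single', single_mul_single', smul_single, smul_comm_coeff,
            mul_smul_comm])

/-- The `ℓ¹`-norm `∑ n, ‖a(n)‖`. -/
noncomputable def l1Norm (x : ConvAlg θ) : ℝ := x.sum fun _ b => ‖b‖

variable (θ) in
/-- The C⋆-seminorms on `C_c(ℤ, B, θ)` dominated by the `ℓ¹`-norm. By continuous extension these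
are the same as the C⋆-seminorms of the Banach `⋆`-algebra `ℓ¹(ℤ, B, θ)`. -/
def BddCStarSeminorm : Type _ :=
  {p : Seminorm ℂ (ConvAlg θ) // IsCStarSeminorm p ∧ ∀ x, p x ≤ l1Norm x}

theorem l1Norm_nonneg (x : ConvAlg θ) : 0 ≤ l1Norm x :=
  Finset.sum_nonneg fun _ _ => norm_nonneg _

noncomputable instance : Inhabited (BddCStarSeminorm θ) :=
  ⟨⟨0, ⟨fun _ _ => by simp, fun _ => by simp⟩, fun x => by simpa using l1Norm_nonneg x⟩⟩

/-- The universal C⋆-seminorm: the supremum of all C⋆-seminorms dominated by the `ℓ¹`-norm. -/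
noncomputable def univNorm (x : ConvAlg θ) : ℝ := ⨆ p : BddCStarSeminorm θ, p.1 x

theorem bddAbove_seminorms (x : ConvAlg θ) :
    BddAbove (Set.range fun p : BddCStarSeminorm θ => p.1 x) :=
  ⟨l1Norm x, by rintro _ ⟨p, rfl⟩; exact p.2.2 x⟩

theorem le_univNorm (p : BddCStarSeminorm θ) (x : ConvAlg θ) : p.1 x ≤ univNorm x :=
  le_ciSup (bddAbove_seminorms x) p

theorem univNorm_nonneg (x : ConvAlg θ) : 0 ≤ univNorm x :=
  Real.iSup_nonneg fun p => apply_nonneg p.1 x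

theorem univNorm_add_le (x y : ConvAlg θ) : univNorm (x + y) ≤ univNorm x + univNorm y :=
  ciSup_le fun p => (map_add_le_add p.1 x y).trans (add_le_add (le_univNorm p x) (le_univNorm p y))

theorem univNorm_neg (x : ConvAlg θ) : univNorm (-x) = univNorm x :=
  iSup_congr fun p => map_neg_eq_map p.1 x

theorem univNorm_mul_le (x y : ConvAlg θ) : univNorm (x * y) ≤ univNorm x * univNorm y :=
  ciSup_le fun p => (p.2.1.mul_le x y).trans
    (mul_le_mul (le_univNorm p x) (le_univNorm p y) (apply_nonneg p.1 y) (univNorm_nonneg x))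

theorem univNorm_smul_le (c : ℂ) (x : ConvAlg θ) : univNorm (c • x) ≤ ‖c‖ * univNorm x :=
  ciSup_le fun p => by
    rw [map_smul_eq_mul]
    exact mul_le_mul_of_nonneg_left (le_univNorm p x) (norm_nonneg c)

theorem univNorm_star (x : ConvAlg θ) : univNorm (star x) = univNorm x :=
  iSup_congr fun p => p.2.1.map_star x

theorem univNorm_sq_le (x : ConvAlg θ) : univNorm x * univNorm x ≤ univNorm (star x * x) := by
  have h : univNorm x ≤ Real.sqrt (univNorm (star x * x)) :=
    ciSup_le fun p => Real.le_sqrt_of_sq_le <| by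
      rw [← p.2.1.star_mul_self]; exact le_univNorm p _
  calc univNorm x * univNorm x
      ≤ Real.sqrt (univNorm (star x * x)) * Real.sqrt (univNorm (star x * x)) :=
        mul_self_le_mul_self (univNorm_nonneg x) h
    _ = univNorm (star x * x) := Real.mul_self_sqrt (univNorm_nonneg _)

/-- `C_c(ℤ, B, θ)` with the universal C⋆-seminorm. -/
noncomputable instance : SeminormedRing (ConvAlg θ) where
  __ := (inferInstance : Ring (ConvAlg θ))
  __ := ({ toFun := univNorm
           map_zero' := le_antisymm (ciSup_le fun p => by simp) (univNorm_nonneg 0)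
           add_le' := univNorm_add_le
           neg' := univNorm_neg } : AddGroupSeminorm (ConvAlg θ)).toSeminormedAddCommGroup
  norm_mul_le := univNorm_mul_le

theorem norm_def (x : ConvAlg θ) : ‖x‖ = univNorm x := rfl

noncomputable instance : NormedAlgebra ℂ (ConvAlg θ) where
  norm_smul_le := univNorm_smul_le

instance : NormedStarGroup (ConvAlg θ) where
  norm_star_le x := (univNorm_star x).le

end ConvAlg

end CStarCrossedProduct

/-- The crossed product `B ⋊_θ ℤ`, that is, the enveloping C⋆-algebra of `ℓ¹(ℤ, B, θ)`: the
(Hausdorff) completion of `C_c(ℤ, B, θ)` in the universal C⋆-seminorm. -/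
def CStarCrossedProduct {B : Type*} [CStarAlgebra B] (θ : B ≃⋆ₐ[ℂ] B) : Type _ :=
  UniformSpace.Completion (CStarCrossedProduct.ConvAlg θ)

namespace CStarCrossedProduct

open UniformSpace

variable {B : Type*} [CStarAlgebra B] {θ : B ≃⋆ₐ[ℂ] B}

noncomputable instance : NormedRing (CStarCrossedProduct θ) :=
  inferInstanceAs (NormedRing (Completion (ConvAlg θ)))

instance : CompleteSpace (CStarCrossedProduct θ) :=
  inferInstanceAs (CompleteSpace (Completion (ConvAlg θ)))

noncomputable instance : Algebra ℂ (CStarCrossedProduct θ) :=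
  inferInstanceAs (Algebra ℂ (Completion (ConvAlg θ)))

/-- The canonical map `C_c(ℤ, B, θ) → B ⋊_θ ℤ`. -/
noncomputable def ofConv (x : ConvAlg θ) : CStarCrossedProduct θ := (x : Completion (ConvAlg θ))

theorem denseRange_ofConv : DenseRange (ofConv (θ := θ)) := Completion.denseRange_coe

theorem continuous_ofConv : Continuous (ofConv (θ := θ)) := Completion.continuous_coe _

theorem norm_ofConv (x : ConvAlg θ) : ‖ofConv x‖ = ConvAlg.univNorm x := Completion.norm_coe x

theorem ofConv_add (x y : ConvAlg θ) : ofConv (x + y) = ofConv x + ofConv y :=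
  Completion.coe_add x y

theorem ofConv_mul (x y : ConvAlg θ) : ofConv (x * y) = ofConv x * ofConv y :=
  Completion.coe_mul x y

theorem ofConv_one : ofConv (1 : ConvAlg θ) = 1 := rfl

theorem ofConv_zero : ofConv (0 : ConvAlg θ) = 0 := rfl

theorem ofConv_smul (c : ℂ) (x : ConvAlg θ) : ofConv (c • x) = c • ofConv x :=
  Completion.coe_smul c x

theorem induction_ofConv {P : CStarCrossedProduct θ → Prop} (x : CStarCrossedProduct θ)
    (hc : IsClosed {x | P x}) (h : ∀ y, P (ofConv y)) : P x :=
  Completion.induction_on (α := ConvAlg θ) x hc h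

theorem induction_ofConv₂ {P : CStarCrossedProduct θ → CStarCrossedProduct θ → Prop}
    (x y : CStarCrossedProduct θ)
    (hc : IsClosed {z : CStarCrossedProduct θ × CStarCrossedProduct θ | P z.1 z.2})
    (h : ∀ a b, P (ofConv a) (ofConv b)) : P x y :=
  Completion.induction_on₂ (α := ConvAlg θ) (β := ConvAlg θ) x y hc h

noncomputable instance : NormedAlgebra ℂ (CStarCrossedProduct θ) where
  norm_smul_le := fun c x => norm_smul_le (β := Completion (ConvAlg θ)) c x

noncomputable instance : Star (CStarCrossedProduct θ) :=
  ⟨Completion.map (star : ConvAlg θ → ConvAlg θ)⟩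

theorem ofConv_star (x : ConvAlg θ) : ofConv (star x) = star (ofConv x) :=
  (Completion.map_coe (star_isometry (E := ConvAlg θ)).uniformContinuous x).symm

theorem continuous_star_aux :
    Continuous (star : CStarCrossedProduct θ → CStarCrossedProduct θ) :=
  Completion.continuous_map

noncomputable instance : StarRing (CStarCrossedProduct θ) where
  star_involutive x := by
    refine induction_ofConv (P := fun x => star (star x) = x) x
      (isClosed_eq (continuous_star_aux.comp continuous_star_aux) continuous_id) fun y => ?_
    rw [← ofConv_star, ← ofConv_star, star_star]
  star_mul x y := by
    refine induction_ofConv₂ (P := fun x y => star (x * y) = star y * star x) x y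
      (isClosed_eq (continuous_star_aux.comp (continuous_fst.mul continuous_snd))
        ((continuous_star_aux.comp continuous_snd).mul (continuous_star_aux.comp continuous_fst)))
      fun a b => ?_
    rw [← ofConv_mul, ← ofConv_star, star_mul, ofConv_mul, ofConv_star, ofConv_star]
  star_add x y := by
    refine induction_ofConv₂ (P := fun x y => star (x + y) = star x + star y) x y
      (isClosed_eq (continuous_star_aux.comp (continuous_fst.add continuous_snd))
        ((continuous_star_aux.comp continuous_fst).add (continuous_star_aux.comp continuous_snd)))
      fun a b => ?_
    rw [← ofConv_add, ← ofConv_star, star_add, ofConv_add, ofConv_star, ofConv_star]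

instance : StarModule ℂ (CStarCrossedProduct θ) where
  star_smul c x := by
    refine induction_ofConv (P := fun x => star (c • x) = star c • star x) x
      (isClosed_eq (continuous_star_aux.comp (continuous_const_smul c))
        (continuous_star_aux.const_smul (star c))) fun y => ?_
    rw [← ofConv_smul, ← ofConv_star, star_smul, ofConv_smul, ofConv_star]

instance : CStarRing (CStarCrossedProduct θ) where
  norm_mul_self_le x := by
    refine induction_ofConv (P := fun x => ‖x‖ * ‖x‖ ≤ ‖star x * x‖) x
      (isClosed_le (continuous_norm.mul continuous_norm)
        (continuous_norm.comp (continuous_star_aux.mul continuous_id))) fun y => ?_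
    rw [← ofConv_star, ← ofConv_mul, norm_ofConv, norm_ofConv]
    exact ConvAlg.univNorm_sq_le y

noncomputable instance : CStarAlgebra (CStarCrossedProduct θ) where

variable (θ) in
/-- The canonical copy of `B` in `B ⋊_θ ℤ`. -/
noncomputable def incl (b : B) : CStarCrossedProduct θ :=
  ofConv (SkewMonoidAlgebra.single (IntAct.of θ 0) b)

variable (θ) in
/-- The canonical unitary of `B ⋊_θ ℤ`. -/
noncomputable def canonicalUnitary : CStarCrossedProduct θ :=
  ofConv (SkewMonoidAlgebra.single (IntAct.of θ 1) 1)

/-! ### The dual action -/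

open SkewMonoidAlgebra

/-- The underlying additive map of the dual action on `C_c(ℤ, B, θ)`: `b δ_n ↦ ζ^n b δ_n`. -/
noncomputable def dualConvAdd (ζ : Circle) : ConvAlg θ →+ ConvAlg θ where
  toFun x := x.sum fun n b => single n (((ζ ^ n.toInt : Circle) : ℂ) • b)
  map_zero' := by simp
  map_add' x y := SkewMonoidAlgebra.sum_add_index' (by simp)
    (by intro n b c; rw [smul_add, single_add])

theorem dualConvAdd_single (ζ : Circle) (n : IntAct θ) (b : B) :
    dualConvAdd ζ (single n b) = single n (((ζ ^ n.toInt : Circle) : ℂ) • b) := by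
  change (single n b).sum (fun n b => single n (((ζ ^ n.toInt : Circle) : ℂ) • b)) = _
  rw [SkewMonoidAlgebra.sum_single_index (by simp)]

theorem dualConvAdd_mul (ζ : Circle) (x y : ConvAlg θ) :
    dualConvAdd ζ (x * y) = dualConvAdd ζ x * dualConvAdd ζ y := by
  induction x using SkewMonoidAlgebra.induction_on' with
  | add x x' hx hx' => rw [add_mul, map_add, hx, hx', map_add, add_mul]
  | single m a =>
    induction y using SkewMonoidAlgebra.induction_on' with
    | add y y' hy hy' => rw [mul_add, map_add, hy, hy', map_add, mul_add]
    | single n b =>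
      have h : (m * n).toInt = m.toInt + n.toInt := rfl
      rw [ConvAlg.single_mul_single', dualConvAdd_single, dualConvAdd_single, dualConvAdd_single,
        ConvAlg.single_mul_single', ConvAlg.smul_comm_coeff, smul_mul_smul_comm, h, zpow_add,
        Circle.coe_mul]

theorem dualConvAdd_smul (ζ : Circle) (c : ℂ) (x : ConvAlg θ) :
    dualConvAdd ζ (c • x) = c • dualConvAdd ζ x := by
  induction x using SkewMonoidAlgebra.induction_on' with
  | add x x' hx hx' => rw [smul_add, map_add, hx, hx', map_add, smul_add]
  | single m a =>
    rw [smul_single, dualConvAdd_single, dualConvAdd_single, smul_single, smul_comm]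

theorem dualConvAdd_star (ζ : Circle) (x : ConvAlg θ) :
    dualConvAdd ζ (star x) = star (dualConvAdd ζ x) := by
  induction x using SkewMonoidAlgebra.induction_on' with
  | add x x' hx hx' => rw [star_add, map_add, hx, hx', map_add, star_add]
  | single n b =>
    have h : (n⁻¹).toInt = -n.toInt := rfl
    rw [dualConvAdd_single, ConvAlg.star_single, ConvAlg.star_single, dualConvAdd_single,
      star_smul, ConvAlg.smul_comm_coeff, h, zpow_neg, Circle.coe_inv_eq_conj]
    rfl

theorem dualConvAdd_one (x : ConvAlg θ) : dualConvAdd 1 x = x := by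
  refine ConvAlg.ext_add (g := AddMonoidHom.id _) (fun n b => ?_) x
  simp [dualConvAdd_single]

theorem dualConvAdd_comp (ζ η : Circle) (x : ConvAlg θ) :
    dualConvAdd (ζ * η) x = dualConvAdd ζ (dualConvAdd η x) := by
  refine ConvAlg.ext_add (g := (dualConvAdd ζ).comp (dualConvAdd η)) (fun n b => ?_) x
  rw [AddMonoidHom.comp_apply, dualConvAdd_single, dualConvAdd_single, dualConvAdd_single,
    smul_smul, mul_zpow, Circle.coe_mul]

theorem l1Norm_dualConvAdd (ζ : Circle) (x : ConvAlg θ) :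
    ConvAlg.l1Norm (dualConvAdd ζ x) = ConvAlg.l1Norm x := by
  have hc : ∀ n, (dualConvAdd ζ x).coeff n = ((ζ ^ n.toInt : Circle) : ℂ) • x.coeff n := by
    intro n
    classical
    induction x using SkewMonoidAlgebra.induction_on' with
    | add x x' hx hx' => rw [map_add, coeff_add, coeff_add, Finsupp.add_apply, Finsupp.add_apply,
        hx, hx', smul_add]
    | single m a =>
      rw [dualConvAdd_single, coeff_single_apply, coeff_single_apply]
      split_ifs with h
      · rw [h]
      · rw [smul_zero]
  have hs : (dualConvAdd ζ x).support = x.support := by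
    ext n
    rw [mem_support_iff, mem_support_iff, hc, ne_eq, ne_eq, smul_eq_zero,
      or_iff_right (Circle.coe_ne_zero _)]
  unfold ConvAlg.l1Norm
  rw [SkewMonoidAlgebra.sum_def', SkewMonoidAlgebra.sum_def', hs]
  refine Finset.sum_congr rfl fun n _ => ?_
  rw [hc, norm_smul, Circle.norm_coe, one_mul]

theorem univNorm_dualConvAdd_le (ζ : Circle) (x : ConvAlg θ) :
    ConvAlg.univNorm (dualConvAdd ζ x) ≤ ConvAlg.univNorm x :=
  ciSup_le fun p => by
    let q : Seminorm ℂ (ConvAlg θ) :=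
      { toFun := fun x => p.1 (dualConvAdd ζ x)
        map_zero' := by rw [map_zero, map_zero]
        add_le' := fun x y => by rw [map_add]; exact map_add_le_add p.1 _ _
        neg' := fun x => by rw [map_neg, map_neg_eq_map]
        smul' := fun c x => by rw [dualConvAdd_smul, map_smul_eq_mul] }
    have hq : IsCStarSeminorm q ∧ ∀ x, q x ≤ ConvAlg.l1Norm x :=
      ⟨⟨fun x y => by
          change p.1 (dualConvAdd ζ (x * y)) ≤ _
          rw [dualConvAdd_mul]; exact p.2.1.mul_le _ _,
        fun x => by
          change p.1 (dualConvAdd ζ (star x * x)) = _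
          rw [dualConvAdd_mul, dualConvAdd_star]; exact p.2.1.star_mul_self _⟩,
        fun x => (p.2.2 _).trans (l1Norm_dualConvAdd ζ x).le⟩
    exact ConvAlg.le_univNorm ⟨q, hq⟩ x

theorem uniformContinuous_dualConvAdd (ζ : Circle) :
    UniformContinuous (dualConvAdd (θ := θ) ζ) :=
  (AddMonoidHomClass.lipschitz_of_bound (dualConvAdd (θ := θ) ζ) 1 fun x => by
    rw [one_mul]; exact univNorm_dualConvAdd_le ζ x).uniformContinuous

/-- The map of `B ⋊_θ ℤ` extending `dualConvAdd ζ`. -/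
noncomputable def dualMap (ζ : Circle) : CStarCrossedProduct θ → CStarCrossedProduct θ :=
  Completion.map (dualConvAdd (θ := θ) ζ)

theorem dualMap_ofConv (ζ : Circle) (x : ConvAlg θ) :
    dualMap ζ (ofConv x) = ofConv (dualConvAdd ζ x) :=
  Completion.map_coe (uniformContinuous_dualConvAdd ζ) x

theorem continuous_dualMap (ζ : Circle) : Continuous (dualMap (θ := θ) ζ) :=
  Completion.continuous_map

theorem dualMap_one (x : CStarCrossedProduct θ) : dualMap 1 x = x :=
  induction_ofConv (P := fun x => dualMap 1 x = x) x
    (isClosed_eq (continuous_dualMap 1) continuous_id) fun y => by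
    rw [dualMap_ofConv, dualConvAdd_one]

theorem dualMap_mul (ζ η : Circle) (x : CStarCrossedProduct θ) :
    dualMap (ζ * η) x = dualMap ζ (dualMap η x) :=
  induction_ofConv (P := fun x => dualMap (ζ * η) x = dualMap ζ (dualMap η x)) x
    (isClosed_eq (continuous_dualMap _)
    ((continuous_dualMap ζ).comp (continuous_dualMap η))) fun y => by
    rw [dualMap_ofConv, dualMap_ofConv, dualMap_ofConv, dualConvAdd_comp]

/-- The automorphism `θ̂_ζ` of `B ⋊_θ ℤ`. -/
noncomputable def dualAut (ζ : Circle) : CStarCrossedProduct θ ≃⋆ₐ[ℂ] CStarCrossedProduct θ where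
  toFun := dualMap ζ
  invFun := dualMap ζ⁻¹
  left_inv x := by rw [← dualMap_mul, inv_mul_cancel, dualMap_one]
  right_inv x := by rw [← dualMap_mul, mul_inv_cancel, dualMap_one]
  map_mul' x y := by
    refine induction_ofConv₂ (P := fun x y => dualMap ζ (x * y) = dualMap ζ x * dualMap ζ y) x y
      (isClosed_eq ((continuous_dualMap ζ).comp (continuous_fst.mul continuous_snd))
        (((continuous_dualMap ζ).comp continuous_fst).mul
          ((continuous_dualMap ζ).comp continuous_snd))) fun a b => ?_
    rw [← ofConv_mul, dualMap_ofConv, dualMap_ofConv, dualMap_ofConv, dualConvAdd_mul, ofConv_mul]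
  map_add' x y := by
    refine induction_ofConv₂ (P := fun x y => dualMap ζ (x + y) = dualMap ζ x + dualMap ζ y) x y
      (isClosed_eq ((continuous_dualMap ζ).comp (continuous_fst.add continuous_snd))
        (((continuous_dualMap ζ).comp continuous_fst).add
          ((continuous_dualMap ζ).comp continuous_snd))) fun a b => ?_
    rw [← ofConv_add, dualMap_ofConv, dualMap_ofConv, dualMap_ofConv, map_add, ofConv_add]
  map_star' x := by
    refine induction_ofConv (P := fun x => dualMap ζ (star x) = star (dualMap ζ x)) x
      (isClosed_eq ((continuous_dualMap ζ).comp continuous_star_aux)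
        (continuous_star_aux.comp (continuous_dualMap ζ))) fun y => ?_
    rw [← ofConv_star, dualMap_ofConv, dualMap_ofConv, dualConvAdd_star, ofConv_star]
  map_smul' c x := by
    refine induction_ofConv (P := fun x => dualMap ζ (c • x) = c • dualMap ζ x) x
      (isClosed_eq ((continuous_dualMap ζ).comp (continuous_const_smul c))
        ((continuous_dualMap ζ).const_smul c)) fun y => ?_
    rw [← ofConv_smul, dualMap_ofConv, dualMap_ofConv, dualConvAdd_smul, ofConv_smul]

variable (θ) in
/-- The dual action `θ̂` of the circle on `B ⋊_θ ℤ`, determined by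
`θ̂_ζ(b v^n) = ζ^n b v^n`, where `v` is the canonical unitary. -/
noncomputable def dualAction :
    Circle →* (CStarCrossedProduct θ ≃⋆ₐ[ℂ] CStarCrossedProduct θ) where
  toFun := dualAut
  map_one' := StarAlgEquiv.ext dualMap_one
  map_mul' ζ η := StarAlgEquiv.ext (dualMap_mul ζ η)

end CStarCrossedProduct

namespace CircleAction

/-- `φ : (A^α ⋊_θ ℤ, θ̂) → (A, α)` is an equivariant isomorphism that is the identity on `A^α`. -/
def IsPredualIso {A : Type*} [CStarAlgebra A] (α : Circle →* (A ≃⋆ₐ[ℂ] A))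
    (θ : fixedPoints α ≃⋆ₐ[ℂ] fixedPoints α) (φ : CStarCrossedProduct θ ≃⋆ₐ[ℂ] A) : Prop :=
  (∀ (ζ : Circle) (x : CStarCrossedProduct θ),
      φ (CStarCrossedProduct.dualAction θ ζ x) = α ζ (φ x)) ∧
    ∀ b : fixedPoints α, φ (CStarCrossedProduct.incl θ b) = (b : A)

end CircleAction

/-! Everything rests on a single unitary v in A with α_ζ(v) = ζv for all ζ. Averaging ζ⁻¹α_ζ(u) over
the circle turns an approximately equivariant unitary u, as given by the Rokhlin property, into an
exact eigenvector x of weight one close to u. Hence x is invertible, and since x⋆x is fixed by the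
action, the unitary part v of its polar decomposition still has weight one
(`HasRokhlinProperty.exists_unitary_apply_eq_smul`). Conjugation by v is then an automorphism θ of
A^α, the inclusion of A^α together with v is a covariant pair, and its integrated form `lift` is
equivariant.

Bijectivity of `lift` is Fourier analysis. By `mem_of_spectralPart_mem`, an element lies in any
closed subspace that contains its spectral components ∫ ζ⁻ⁿα_ζ(a) dζ. In A the component of weight n
has the form b vⁿ with b in A^α, and `spectralPart_dualAction` recovers each component of x in the
crossed product from that of its image. The zero subspace then gives injectivity. The range of
`lift`, closed because an injective ⋆-homomorphism is isometric, gives surjectivity.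

For uniqueness, an equivariant isomorphism fixing A^α carries the canonical unitary to a weight-one
unitary implementing θ. Two such unitaries v, v' differ by w = v v'⋆, which has weight zero and so
lies in A^α. -/

section

/-! ### Fourier coefficients and spectral components of a circle action -/

open MeasureTheory AddCircle

/-- A continuous function on the circle with vanishing Fourier coefficients is zero. -/
theorem eq_zero_of_fourierCoeff_eq_zero {E : Type*} [NormedAddCommGroup E] [NormedSpace ℂ E]
    [CompleteSpace E] {f : UnitAddCircle → E} (hf : Continuous f)
    (h : ∀ n, fourierCoeff f n = 0) (t : UnitAddCircle) : f t = 0 := by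
  -- Functionals separate points and commute with the integral, so the scalar case suffices.
  refine SeparatingDual.eq_zero_of_forall_dual_eq_zero (R := ℂ) fun l => ?_
  let g : C(UnitAddCircle, ℂ) := ⟨fun t => l (f t), l.continuous.comp hf⟩
  have hg : fourierCoeff g = 0 := by
    funext n
    have hi : Integrable (fun t => fourier (-n) t • f t) (haarAddCircle (T := 1)) :=
      ((fourier (-n)).continuous.smul hf).integrable_of_hasCompactSupport
        (HasCompactSupport.of_compactSpace _)
    have := l.integral_comp_comm hi
    rw [show ∫ t, fourier (-n) t • f t ∂(haarAddCircle (T := 1)) = 0 from h n, map_zero] at this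
    simp only [map_smul] at this
    exact this
  -- Vanishing coefficients are trivially summable, so the Fourier series converges pointwise to the
  -- function; no Fejér summation is needed.
  have hs := has_pointwise_sum_fourier_series_of_summable (f := g)
    (by rw [hg]; exact summable_zero) t
  simp only [hg, Pi.zero_apply, zero_smul] at hs
  exact hs.unique hasSum_zero

namespace CircleAction

variable {A : Type*} [CStarAlgebra A] (α : Circle →* (A ≃⋆ₐ[ℂ] A))

theorem norm_apply (ζ : Circle) (a : A) : ‖α ζ a‖ = ‖a‖ :=
  StarAlgEquiv.norm_map (α ζ) a

/-- The `n`-th spectral component `∫ ζ^{-n} α_ζ(a) dζ` of `a`. -/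
noncomputable def spectralPart (n : ℤ) (a : A) : A :=
  fourierCoeff (fun t : UnitAddCircle => α (toCircle t) a) n

variable {α}

theorem integrable_orbit (hα : ∀ a : A, Continuous fun ζ : Circle => α ζ a) (n : ℤ) (a : A) :
    Integrable (fun t => fourier n t • α (toCircle t) a) (haarAddCircle (T := 1)) :=
  ((fourier n).continuous.smul ((hα a).comp continuous_toCircle)).integrable_of_hasCompactSupport
    (HasCompactSupport.of_compactSpace _)

theorem norm_spectralPart_le (n : ℤ) (a : A) : ‖spectralPart α n a‖ ≤ ‖a‖ := by
  refine (norm_integral_le_of_norm_le_const (C := ‖a‖) (.of_forall fun t => ?_)).trans ?_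
  · rw [norm_smul, norm_apply, fourier_apply, Circle.norm_coe, one_mul]
  · simp

theorem spectralPart_add (hα : ∀ a : A, Continuous fun ζ : Circle => α ζ a) (n : ℤ) (a b : A) :
    spectralPart α n (a + b) = spectralPart α n a + spectralPart α n b := by
  simp only [spectralPart, fourierCoeff, map_add, smul_add]
  exact integral_add (integrable_orbit hα _ a) (integrable_orbit hα _ b)

theorem continuous_spectralPart (hα : ∀ a : A, Continuous fun ζ : Circle => α ζ a) (n : ℤ) :
    Continuous (spectralPart α n) := by
  let f : A →+ A :=
    { toFun := spectralPart α n
      map_zero' := by simp [spectralPart, fourierCoeff]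
      map_add' := spectralPart_add hα n }
  exact AddMonoidHomClass.continuous_of_bound f 1 fun a => by
    rw [one_mul]; exact norm_spectralPart_le n a

/-- Translation invariance of Haar measure: with η = `toCircle s`, replacing t by s + t absorbs α_η
into the orbit and leaves the factor ηⁿ. -/
theorem apply_spectralPart (hα : ∀ a : A, Continuous fun ζ : Circle => α ζ a) (n : ℤ) (a : A)
    (η : Circle) : α η (spectralPart α n a) = ((η ^ n : Circle) : ℂ) • spectralPart α n a := by
  obtain ⟨s, rfl⟩ : ∃ s : UnitAddCircle, toCircle s = η :=
    ⟨(homeomorphCircle one_ne_zero).symm η, by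
      rw [← homeomorphCircle_apply one_ne_zero, Homeomorph.apply_symm_apply]⟩
  let L : A →L[ℂ] A :=
    ⟨(α (toCircle s)).toAlgEquiv.toLinearMap, (StarAlgEquiv.isometry (α (toCircle s))).continuous⟩
  have h := L.integral_comp_comm (integrable_orbit hα (-n) a)
  change _ = α (toCircle s) (spectralPart α n a) at h
  rw [← h, spectralPart, fourierCoeff, ← integral_smul,
    ← integral_add_left_eq_self (fun t => _ • fourier (-n) t • α (toCircle t) a) s]
  refine integral_congr_ae (.of_forall fun t => ?_)
  change α (toCircle s) (fourier (-n) t • α (toCircle t) a) = _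
  simp only [map_smul, toCircle_add, map_mul, StarAlgEquiv.mul_apply, smul_smul]
  congr 1
  simp only [fourier_apply, smul_add, toCircle_add, ← Circle.coe_mul, toCircle_zsmul]
  simp only [zpow_neg, mul_inv_cancel_left]

/-- Orthogonality of characters: the integrand is a scalar character times the constant vector a. -/
theorem spectralPart_of_apply_eq {m : ℤ} {a : A}
    (ha : ∀ ζ : Circle, α ζ a = ((ζ ^ m : Circle) : ℂ) • a) (n : ℤ) :
    spectralPart α n a = (Pi.single m 1 : ℤ → ℂ) n • a := by
  rw [← fourierCoeff_fourier (T := 1), fourierCoeff, ← integral_smul_const]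
  refine integral_congr_ae (.of_forall fun t => ?_)
  simp only [ha, smul_smul, fourier_apply, toCircle_zsmul, smul_eq_mul]

/-- An element lies in every closed subspace that contains its spectral components. -/
theorem mem_of_spectralPart_mem (hα : ∀ a : A, Continuous fun ζ : Circle => α ζ a)
    {S : Submodule ℂ A} (hS : IsClosed (S : Set A)) {a : A} (h : ∀ n, spectralPart α n a ∈ S) :
    a ∈ S := by
  have := hS
  -- Modulo S the orbit of a has vanishing Fourier coefficients, hence vanishes identically; its
  -- value at t = 0 is the class of a.
  let q : A →L[ℂ] A ⧸ S := ⟨S.mkQ, continuous_quot_mk⟩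
  have hq : ∀ n, fourierCoeff (fun t : UnitAddCircle => q (α (toCircle t) a)) n = 0 := by
    intro n
    have := q.integral_comp_comm (integrable_orbit hα (-n) a)
    simp only [map_smul] at this
    exact this.trans ((Submodule.Quotient.mk_eq_zero S).2 (h n))
  have := eq_zero_of_fourierCoeff_eq_zero
    (q.continuous.comp ((hα a).comp continuous_toCircle)) hq 0
  change q (α (toCircle (0 : AddCircle (1 : ℝ))) a) = 0 at this
  rw [toCircle_zero, map_one] at this
  exact (Submodule.Quotient.mk_eq_zero S).1 this

end CircleAction

/-! ### Polar decomposition and the unitary eigenvector of weight one -/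

/-- On the spectrum this is r^(-1/2) · r · r^(-1/2) = 1. Positivity keeps the spectrum away from 0,
where the inverse square root is discontinuous. -/
theorem cfc_inv_sqrt_mul_mul_cfc_inv_sqrt {A : Type*} [CStarAlgebra A] {h : A}
    (hsa : IsSelfAdjoint h) (hpos : ∀ r ∈ spectrum ℝ h, 0 < r) :
    cfc (fun r : ℝ => (√r)⁻¹) h * h * cfc (fun r : ℝ => (√r)⁻¹) h = 1 := by
  have hc : ContinuousOn (fun r : ℝ => (√r)⁻¹) (spectrum ℝ h) :=
    Real.continuous_sqrt.continuousOn.inv₀ fun r hr => (Real.sqrt_pos.2 (hpos r hr)).ne'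
  have e₁ := cfc_mul (fun r : ℝ => (√r)⁻¹) (fun r => r) h hc continuousOn_id
  have e₂ := cfc_mul (fun r : ℝ => (√r)⁻¹ * r) (fun r => (√r)⁻¹) h (hc.mul continuousOn_id) hc
  rw [cfc_id' ℝ h hsa] at e₁
  rw [← e₁, ← e₂, ← cfc_one ℝ h hsa]
  refine cfc_congr fun r hr => ?_
  have h0 := Real.sqrt_pos.2 (hpos r hr)
  have h1 := Real.mul_self_sqrt (hpos r hr).le
  rw [Pi.one_apply]
  field_simp
  linarith

theorem IsUnit.spectrum_star_mul_self_pos {A : Type*} [CStarAlgebra A] {x : A} (hx : IsUnit x)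
    {r : ℝ} (hr : r ∈ spectrum ℝ (star x * x)) : 0 < r :=
  lt_of_le_of_ne (spectrum_star_mul_self_nonneg r hr) fun h0 =>
    (spectrum.zero_notMem_iff ℝ).2 (hx.star.mul hx) (h0 ▸ hr)

/-- The unitary part of the polar decomposition of an invertible element. -/
theorem IsUnit.mul_cfc_inv_sqrt_mem_unitary {A : Type*} [CStarAlgebra A] {x : A}
    (hx : IsUnit x) : x * cfc (fun r : ℝ => (√r)⁻¹) (star x * x) ∈ unitary A := by
  have hshs := cfc_inv_sqrt_mul_mul_cfc_inv_sqrt (.star_mul_self x)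
    fun _ => hx.spectrum_star_mul_self_pos
  have hss : star (cfc (fun r : ℝ => (√r)⁻¹) (star x * x)) = _ :=
    cfc_predicate (p := IsSelfAdjoint) (fun r : ℝ => (√r)⁻¹) (star x * x)
  generalize cfc (fun r : ℝ => (√r)⁻¹) (star x * x) = s at hshs hss
  have h1 : star (x * s) * (x * s) = 1 := by
    rw [star_mul, hss, ← hshs]; simp only [mul_assoc]
  -- With h = x⋆x, the identity s h s = 1 gives s the left inverse s h and the right inverse h s,
  -- which therefore agree.
  have hsu : IsUnit s :=
    ⟨⟨s, star x * x * s, by rw [← mul_assoc, hshs],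
      by
        have hr : s * (star x * x * s) = 1 := by rw [← mul_assoc, hshs]
        rw [← left_inv_eq_right_inv hshs hr, hshs]⟩, rfl⟩
  -- An invertible isometry is unitary: its adjoint is a left inverse, hence the inverse.
  refine Unitary.mem_iff.2 ⟨h1, ?_⟩
  obtain ⟨w, hw⟩ := hx.mul hsu
  rw [← hw] at h1 ⊢
  rw [show star (w : A) = ↑w⁻¹ from Units.eq_inv_of_mul_eq_one_right h1, Units.mul_inv]

namespace CircleAction

variable {A : Type*} [CStarAlgebra A] {α : Circle →* (A ≃⋆ₐ[ℂ] A)}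

/-- An action with the Rokhlin property has a unitary eigenvector of weight one. -/
theorem HasRokhlinProperty.exists_unitary_apply_eq_smul
    (hα : ∀ a : A, Continuous fun ζ : Circle => α ζ a) (hR : HasRokhlinProperty α) :
    ∃ v ∈ unitary A, ∀ ζ : Circle, α ζ v = (ζ : ℂ) • v := by
  -- Any tolerance below 1 would do: it bounds ‖x - u‖, and a distance below 1 from a unitary forces
  -- invertibility.
  obtain ⟨u, hu, hαu, -⟩ := hR (1 / 2) (by norm_num) ∅
  set x := spectralPart α 1 u with hx
  have hαx : ∀ ζ : Circle, α ζ x = (ζ : ℂ) • x := fun ζ => by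
    rw [hx, apply_spectralPart hα, zpow_one]
  have hxu : ‖x - u‖ ≤ 1 / 2 := by
    -- Haar measure has mass one, so u is its own average; the integrand then has the norm of α_ζ(u)
    -- - ζu.
    have : x - u = ∫ t, (fourier (-1) t • α (toCircle t) u - u) ∂(haarAddCircle (T := 1)) := by
      rw [integral_sub (integrable_orbit hα (-1) u) (integrable_const u)]
      simp [hx, spectralPart, fourierCoeff]
    rw [this]
    refine (norm_integral_le_of_norm_le_const (C := 1 / 2) (.of_forall fun t => ?_)).trans
      (by simp)
    have : fourier (-1) t • α (toCircle t) u - u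
        = fourier (-1) t • (α (toCircle t) u - (toCircle t : ℂ) • u) := by
      rw [smul_sub, smul_smul, fourier_apply, ← Circle.coe_mul, neg_one_zsmul, toCircle_neg,
        inv_mul_cancel, Circle.coe_one, one_smul]
    rw [this, norm_smul, fourier_apply, Circle.norm_coe, one_mul]
    exact (hαu _).le
  have hxunit : IsUnit x := by
    have h1 : ‖1 - star u * x‖ < 1 := by
      rw [← Unitary.star_mul_self_of_mem hu, ← mul_sub,
        CStarRing.norm_mem_unitary_mul _ (Unitary.star_mem hu), norm_sub_rev]
      linarith
    have h2 : IsUnit (star u * x) := by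
      simpa using (Units.oneSub _ h1).isUnit
    have h3 := (Unitary.toUnits ⟨u, hu⟩).isUnit.mul h2
    rwa [Unitary.val_toUnits_apply, ← mul_assoc, Unitary.mul_star_self_of_mem hu, one_mul] at h3
  refine ⟨_, hxunit.mul_cfc_inv_sqrt_mem_unitary, fun ζ => ?_⟩
  -- The phases of x⋆ and x cancel. The functional calculus of x⋆x is then fixed as well, so the
  -- unitary part has the same weight as x.
  have hh : α ζ (star x * x) = star x * x := by
    rw [map_mul, map_star, hαx, star_smul, smul_mul_smul_comm]
    simp [← Complex.normSq_eq_conj_mul_self]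
  rw [map_mul, hαx, StarAlgHomClass.map_cfc (α ζ) (fun r : ℝ => (√r)⁻¹) (star x * x)
    (Real.continuous_sqrt.continuousOn.inv₀ fun r hr =>
      (Real.sqrt_pos.2 (hxunit.spectrum_star_mul_self_pos hr)).ne')
    (StarAlgEquiv.isometry (α ζ)).continuous (.star_mul_self x)
    (by rw [hh]; exact .star_mul_self x), hh, smul_mul_assoc]

end CircleAction

end

/-! ### Covariant pairs and the universal property of the crossed product -/

namespace CStarCrossedProduct

open SkewMonoidAlgebra UniformSpace

variable {B : Type*} [CStarAlgebra B] {θ : B ≃⋆ₐ[ℂ] B} {A : Type*} [CStarAlgebra A]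

theorem zpow_mul_of_covariant {π : B →⋆ₐ[ℂ] A} {v : unitary A}
    (h : ∀ b, (v : A) * π b = π (θ b) * v) (n : ℤ) (b : B) :
    ((v ^ n : unitary A) : A) * π b = π ((θ ^ n) b) * ((v ^ n : unitary A) : A) := by
  -- Negative powers need the covariance relation for v⁻¹ and θ⁻¹, obtained by applying the given
  -- one at θ⁻¹(b).
  have hinv : ∀ b, ((v⁻¹ : unitary A) : A) * π b = π (θ⁻¹ b) * ((v⁻¹ : unitary A) : A) := by
    intro b
    have h' := h (θ⁻¹ b)
    rw [show θ (θ⁻¹ b) = b from θ.apply_symm_apply b] at h'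
    rw [← Unitary.star_eq_inv, Unitary.coe_star]
    calc star (v : A) * π b = star (v : A) * (π b * v) * star (v : A) := by
          rw [mul_assoc, mul_assoc, Unitary.mul_star_self_of_mem v.2, mul_one]
      _ = _ := by rw [← h', ← mul_assoc, Unitary.star_mul_self_of_mem v.2, one_mul]
  induction n generalizing b with
  | zero => simp
  | succ n ih =>
    rw [zpow_add_one, zpow_add_one, Submonoid.coe_mul, mul_assoc, h, ← mul_assoc, ih, mul_assoc]
    rfl
  | pred n ih =>
    rw [zpow_sub_one, zpow_sub_one, Submonoid.coe_mul, mul_assoc, hinv, ← mul_assoc, ih,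
      mul_assoc]
    rfl

section Integrated

variable (π : B →⋆ₐ[ℂ] A) (v : unitary A)

/-- The integrated form `∑ b_n δ_n ↦ ∑ π(b_n) v^n` of a pair `(π, v)`. -/
noncomputable def integratedAdd : ConvAlg θ →+ A where
  toFun x := x.sum fun n b => π b * ((v ^ n.toInt : unitary A) : A)
  map_zero' := by simp
  map_add' x y := SkewMonoidAlgebra.sum_add_index' (by simp)
    (by intro n b c; rw [map_add, add_mul])

theorem integratedAdd_single (n : IntAct θ) (b : B) :
    integratedAdd π v (single n b) = π b * ((v ^ n.toInt : unitary A) : A) := by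
  change (single n b).sum (fun n b => π b * ((v ^ n.toInt : unitary A) : A)) = _
  rw [SkewMonoidAlgebra.sum_single_index (by simp)]

theorem integratedAdd_smul (c : ℂ) (x : ConvAlg θ) :
    integratedAdd π v (c • x) = c • integratedAdd π v x := by
  induction x using SkewMonoidAlgebra.induction_on' with
  | add x x' hx hx' => rw [smul_add, map_add, hx, hx', map_add, smul_add]
  | single m a =>
    rw [smul_single, integratedAdd_single, integratedAdd_single, map_smul, smul_mul_assoc]

theorem norm_integratedAdd_le_l1Norm (x : ConvAlg θ) :
    ‖integratedAdd π v x‖ ≤ ConvAlg.l1Norm x := by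
  change ‖x.sum fun n b => π b * ((v ^ n.toInt : unitary A) : A)‖ ≤ x.sum fun _ b => ‖b‖
  rw [SkewMonoidAlgebra.sum_def', SkewMonoidAlgebra.sum_def']
  refine norm_sum_le_of_le _ fun n _ => ?_
  rw [CStarRing.norm_mul_coe_unitary]
  exact NonUnitalStarAlgHom.norm_apply_le π _

variable {π v}

theorem integratedAdd_mul (h : ∀ b, (v : A) * π b = π (θ b) * v) (x y : ConvAlg θ) :
    integratedAdd π v (x * y) = integratedAdd π v x * integratedAdd π v y := by
  induction x using SkewMonoidAlgebra.induction_on' with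
  | add x x' hx hx' => rw [add_mul, map_add, hx, hx', map_add, add_mul]
  | single m a =>
    induction y using SkewMonoidAlgebra.induction_on' with
    | add y y' hy hy' => rw [mul_add, map_add, hy, hy', map_add, mul_add]
    | single n b =>
      have hmn : (m * n).toInt = m.toInt + n.toInt := rfl
      rw [ConvAlg.single_mul_single', integratedAdd_single, integratedAdd_single,
        integratedAdd_single, IntAct.smul_def, hmn, zpow_add, Submonoid.coe_mul, map_mul,
        mul_assoc, ← mul_assoc (π ((θ ^ m.toInt) b)), ← zpow_mul_of_covariant h]
      simp only [mul_assoc]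

theorem integratedAdd_star (h : ∀ b, (v : A) * π b = π (θ b) * v) (x : ConvAlg θ) :
    integratedAdd π v (star x) = star (integratedAdd π v x) := by
  induction x using SkewMonoidAlgebra.induction_on' with
  | add x x' hx hx' => rw [star_add, map_add, hx, hx', map_add, star_add]
  | single n b =>
    have hn : (n⁻¹).toInt = -n.toInt := rfl
    rw [ConvAlg.star_single, integratedAdd_single, integratedAdd_single, IntAct.smul_def, hn,
      ← zpow_mul_of_covariant h, star_mul, map_star, zpow_neg, ← Unitary.star_eq_inv,
      Unitary.coe_star]

/-- The norm of the integrated form is itself one of the C⋆-seminorms whose supremum defines the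
universal norm. -/
theorem norm_integratedAdd_le (h : ∀ b, (v : A) * π b = π (θ b) * v) (x : ConvAlg θ) :
    ‖integratedAdd π v x‖ ≤ ConvAlg.univNorm x := by
  let p : Seminorm ℂ (ConvAlg θ) :=
    { toFun := fun x => ‖integratedAdd π v x‖
      map_zero' := by rw [map_zero, norm_zero]
      add_le' := fun x y => by rw [map_add]; exact norm_add_le _ _
      neg' := fun x => by rw [map_neg, norm_neg]
      smul' := fun c x => by rw [integratedAdd_smul, norm_smul] }
  have hp : IsCStarSeminorm p :=
    ⟨fun x y => by
      change ‖integratedAdd π v (x * y)‖ ≤ _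
      rw [integratedAdd_mul h]; exact norm_mul_le _ _,
    fun x => by
      change ‖integratedAdd π v (star x * x)‖ = _
      rw [integratedAdd_mul h, integratedAdd_star h, CStarRing.norm_star_mul_self, sq]; rfl⟩
  exact ConvAlg.le_univNorm ⟨p, hp, norm_integratedAdd_le_l1Norm π v⟩ x

theorem uniformContinuous_integratedAdd (h : ∀ b, (v : A) * π b = π (θ b) * v) :
    UniformContinuous (integratedAdd (θ := θ) π v) :=
  (AddMonoidHomClass.lipschitz_of_bound (integratedAdd (θ := θ) π v) 1 fun x => by
    rw [one_mul]; exact norm_integratedAdd_le h x).uniformContinuous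

variable (θ π v) in
/-- The map of `B ⋊_θ ℤ` extending `integratedAdd`. -/
noncomputable def integratedMap : CStarCrossedProduct θ → A :=
  Completion.extension (integratedAdd (θ := θ) π v)

theorem continuous_integratedMap : Continuous (integratedMap θ π v) :=
  Completion.continuous_extension

theorem integratedMap_ofConv (h : ∀ b, (v : A) * π b = π (θ b) * v) (x : ConvAlg θ) :
    integratedMap θ π v (ofConv x) = integratedAdd π v x :=
  Completion.extension_coe (uniformContinuous_integratedAdd h) x

/-- The `⋆`-homomorphism of `B ⋊_θ ℤ` given by a covariant pair. -/
noncomputable def lift (h : ∀ b, (v : A) * π b = π (θ b) * v) :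
    CStarCrossedProduct θ →⋆ₐ[ℂ] A where
  toFun := integratedMap θ π v
  map_one' := by
    rw [← ofConv_one, integratedMap_ofConv h]
    refine (integratedAdd_single π v (1 : IntAct θ) 1).trans ?_
    change π 1 * ((v ^ (0 : ℤ) : unitary A) : A) = 1
    simp
  map_zero' := by rw [← ofConv_zero, integratedMap_ofConv h, map_zero]
  map_mul' x y := by
    refine induction_ofConv₂
      (P := fun x y => integratedMap θ π v (x * y) = integratedMap θ π v x * integratedMap θ π v y)
      x y (isClosed_eq (continuous_integratedMap.comp (continuous_fst.mul continuous_snd))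
        ((continuous_integratedMap.comp continuous_fst).mul
          (continuous_integratedMap.comp continuous_snd))) fun a b => ?_
    rw [← ofConv_mul, integratedMap_ofConv h, integratedMap_ofConv h, integratedMap_ofConv h,
      integratedAdd_mul h]
  map_add' x y := by
    refine induction_ofConv₂
      (P := fun x y => integratedMap θ π v (x + y) = integratedMap θ π v x + integratedMap θ π v y)
      x y (isClosed_eq (continuous_integratedMap.comp (continuous_fst.add continuous_snd))
        ((continuous_integratedMap.comp continuous_fst).add
          (continuous_integratedMap.comp continuous_snd))) fun a b => ?_
    rw [← ofConv_add, integratedMap_ofConv h, integratedMap_ofConv h, integratedMap_ofConv h,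
      map_add]
  map_star' x := by
    refine induction_ofConv
      (P := fun x => integratedMap θ π v (star x) = star (integratedMap θ π v x)) x
      (isClosed_eq (continuous_integratedMap.comp continuous_star_aux)
        continuous_integratedMap.star) fun y => ?_
    rw [← ofConv_star, integratedMap_ofConv h, integratedMap_ofConv h, integratedAdd_star h]
  commutes' c := by
    rw [Algebra.algebraMap_eq_smul_one, ← ofConv_one, ← ofConv_smul, integratedMap_ofConv h,
      integratedAdd_smul, Algebra.algebraMap_eq_smul_one]
    congr 1
    refine (integratedAdd_single π v (1 : IntAct θ) 1).trans ?_
    change π 1 * ((v ^ (0 : ℤ) : unitary A) : A) = 1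
    simp

theorem lift_ofConv_single (h : ∀ b, (v : A) * π b = π (θ b) * v) (n : IntAct θ) (b : B) :
    lift h (ofConv (single n b)) = π b * ((v ^ n.toInt : unitary A) : A) :=
  (integratedMap_ofConv h _).trans (integratedAdd_single π v n b)

theorem continuous_lift (h : ∀ b, (v : A) * π b = π (θ b) * v) : Continuous (lift h) :=
  continuous_integratedMap

end Integrated

/-- Induction from the elements `b v^n`. -/
theorem induction_single {P : CStarCrossedProduct θ → Prop} (x : CStarCrossedProduct θ)
    (hc : IsClosed {x | P x}) (hs : ∀ n b, P (ofConv (single n b)))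
    (ha : ∀ y z, P y → P z → P (y + z)) : P x := by
  refine induction_ofConv x hc fun y => ?_
  induction y using SkewMonoidAlgebra.induction_on' with
  | add y z hy hz => rw [ofConv_add]; exact ha _ _ hy hz
  | single n b => exact hs n b

theorem dualAction_ofConv_single (ζ : Circle) (n : IntAct θ) (b : B) :
    dualAction θ ζ (ofConv (single n b)) =
      ((ζ ^ n.toInt : Circle) : ℂ) • ofConv (single n b) := by
  change dualMap ζ _ = _
  rw [dualMap_ofConv, dualConvAdd_single, ← smul_single, ofConv_smul]

/-- Makes the spectral theory above available for the dual action. Orbits of finitely supported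
elements are continuous, and since the action is isometric, other orbits are uniform limits of
these. -/
theorem continuous_dualAction (x : CStarCrossedProduct θ) :
    Continuous fun ζ : Circle => dualAction θ ζ x := by
  have hd : ∀ y : ConvAlg θ, Continuous fun ζ : Circle => dualAction θ ζ (ofConv y) := by
    intro y
    induction y using SkewMonoidAlgebra.induction_on' with
    | add y z hy hz => simp only [ofConv_add, map_add]; exact hy.add hz
    | single n b =>
      simp only [dualAction_ofConv_single]
      have hz : Continuous fun ζ : Circle => ζ ^ n.toInt := continuous_zpow _
      exact Continuous.smul (continuous_induced_dom.comp hz) continuous_const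
  refine continuous_of_uniform_approx_of_continuous fun u hu => ?_
  obtain ⟨ε, hε, hεu⟩ := Metric.mem_uniformity_dist.1 hu
  obtain ⟨y, hy⟩ := (Metric.denseRange_iff.1 denseRange_ofConv) x ε hε
  refine ⟨_, hd y, fun ζ => hεu ?_⟩
  rwa [(StarAlgEquiv.isometry (dualAction θ ζ)).dist_eq]

/-- Every seminorm in the supremum is dominated by the ℓ¹-norm, which equals ‖b‖ on b δ_n, so the
map is contractive. -/
theorem continuous_ofConv_single (n : IntAct θ) :
    Continuous fun b : B => (ofConv (single n b) : CStarCrossedProduct θ) := by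
  let f : B →+ CStarCrossedProduct θ :=
    { toFun := fun b => ofConv (single n b)
      map_zero' := by rw [single_zero, ofConv_zero]
      map_add' := fun b c => by rw [single_add, ofConv_add] }
  refine AddMonoidHomClass.continuous_of_bound f 1 fun b => ?_
  change ‖(ofConv (single n b) : CStarCrossedProduct θ)‖ ≤ _
  rw [norm_ofConv, one_mul]
  refine ciSup_le fun p => (p.2.2 _).trans_eq ?_
  exact SkewMonoidAlgebra.sum_single_index norm_zero

variable (θ) in
theorem canonicalUnitary_mul_incl (b : B) :
    canonicalUnitary θ * incl θ b = incl θ (θ b) * canonicalUnitary θ := by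
  rw [canonicalUnitary, incl, incl, ← ofConv_mul, ← ofConv_mul, ConvAlg.single_mul_single',
    ConvAlg.single_mul_single', IntAct.smul_def, IntAct.smul_def, map_one, one_mul, mul_one,
    mul_comm]
  change ofConv (single _ ((θ ^ (1 : ℤ)) b)) = _
  rw [zpow_one]

variable (θ) in
theorem canonicalUnitary_mem_unitary : canonicalUnitary θ ∈ unitary (CStarCrossedProduct θ) := by
  rw [Unitary.mem_iff, canonicalUnitary, ← ofConv_star, ← ofConv_mul, ← ofConv_mul,
    ConvAlg.star_single, ConvAlg.single_mul_single', ConvAlg.single_mul_single', ← ofConv_one]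
  simp

variable (θ) in
theorem dualAction_canonicalUnitary (ζ : Circle) :
    dualAction θ ζ (canonicalUnitary θ) = (ζ : ℂ) • canonicalUnitary θ := by
  refine (dualAction_ofConv_single ζ (IntAct.of θ 1) 1).trans ?_
  change ((ζ ^ (1 : ℤ) : Circle) : ℂ) • canonicalUnitary θ = _
  rw [zpow_one]

end CStarCrossedProduct

/-! ### The predual automorphism and bijectivity of the integrated form -/

namespace CircleAction

open SkewMonoidAlgebra CStarCrossedProduct

variable {A : Type*} [CStarAlgebra A] {α : Circle →* (A ≃⋆ₐ[ℂ] A)}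

theorem apply_star {v : unitary A} (hv : ∀ ζ : Circle, α ζ v = (ζ : ℂ) • (v : A)) (ζ : Circle) :
    α ζ (star (v : A)) = ((ζ ^ (-1 : ℤ) : Circle) : ℂ) • star (v : A) := by
  rw [map_star, hv, star_smul, zpow_neg_one, Circle.coe_inv_eq_conj]
  rfl

theorem apply_zpow {v : unitary A} (hv : ∀ ζ : Circle, α ζ v = (ζ : ℂ) • (v : A)) (n : ℤ)
    (ζ : Circle) : α ζ (v ^ n : unitary A) = ((ζ ^ n : Circle) : ℂ) • ((v ^ n : unitary A) : A) := by
  have hinv : α ζ (v⁻¹ : unitary A) = ((ζ⁻¹ : Circle) : ℂ) • ((v⁻¹ : unitary A) : A) := by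
    rw [← Unitary.star_eq_inv, Unitary.coe_star, apply_star hv, zpow_neg_one]
  induction n with
  | zero => simp
  | succ n ih =>
    rw [zpow_add_one, zpow_add_one, Submonoid.coe_mul, map_mul, ih, hv, smul_mul_smul_comm,
      Circle.coe_mul]
  | pred n ih =>
    rw [zpow_sub_one, zpow_sub_one, Submonoid.coe_mul, map_mul, ih, hinv, smul_mul_smul_comm,
      Circle.coe_mul]

/-- Weights add under multiplication. This puts v b v⋆, the coefficients of an element, and the
intertwiner v v'⋆ into the fixed point algebra. -/
theorem mul_mem_fixedPoints_of_apply_eq_smul {a b : A} {n : ℤ}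
    (ha : ∀ ζ : Circle, α ζ a = ((ζ ^ n : Circle) : ℂ) • a)
    (hb : ∀ ζ : Circle, α ζ b = ((ζ ^ (-n) : Circle) : ℂ) • b) : a * b ∈ fixedPoints α := by
  intro ζ
  rw [map_mul, ha, hb, smul_mul_smul_comm, ← Circle.coe_mul, ← zpow_add, add_neg_cancel, zpow_zero,
    Circle.coe_one, one_smul]

theorem conj_mem_fixedPoints {v : unitary A} (hv : ∀ ζ : Circle, α ζ v = (ζ : ℂ) • (v : A))
    {b : A} (hb : b ∈ fixedPoints α) : (v : A) * b * star (v : A) ∈ fixedPoints α := by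
  refine mul_mem_fixedPoints_of_apply_eq_smul (n := 1) (fun ζ => ?_) fun ζ => ?_
  · rw [map_mul, hv, hb, zpow_one, smul_mul_assoc]
  · exact apply_star hv ζ

theorem star_conj_mem_fixedPoints {v : unitary A} (hv : ∀ ζ : Circle, α ζ v = (ζ : ℂ) • (v : A))
    {b : A} (hb : b ∈ fixedPoints α) : star (v : A) * b * v ∈ fixedPoints α := by
  refine mul_mem_fixedPoints_of_apply_eq_smul (n := -1) (fun ζ => ?_) fun ζ => ?_
  · rw [map_mul, hb, ← smul_mul_assoc]
    congr 1
    exact apply_star hv ζ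
  · simpa using hv ζ

/-- The automorphism `b ↦ v b v⋆` of the fixed point algebra, for a unitary eigenvector `v` of
weight one. -/
noncomputable def conjFixedPoints (v : unitary A) (hv : ∀ ζ : Circle, α ζ v = (ζ : ℂ) • (v : A)) :
    fixedPoints α ≃⋆ₐ[ℂ] fixedPoints α where
  toFun b := ⟨v * b * star (v : A), conj_mem_fixedPoints hv b.2⟩
  invFun b := ⟨star (v : A) * b * v, star_conj_mem_fixedPoints hv b.2⟩
  left_inv b := by
    ext
    change star (v : A) * (v * b * star (v : A)) * v = b
    simp only [mul_assoc, Unitary.star_mul_self_of_mem v.2, mul_one]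
    rw [← mul_assoc, Unitary.star_mul_self_of_mem v.2, one_mul]
  right_inv b := by
    ext
    change (v : A) * (star (v : A) * b * v) * star (v : A) = b
    simp only [mul_assoc, Unitary.mul_star_self_of_mem v.2, mul_one]
    rw [← mul_assoc, Unitary.mul_star_self_of_mem v.2, one_mul]
  map_mul' b c := by
    ext
    change (v : A) * (b * c) * star (v : A) = v * b * star (v : A) * (v * c * star (v : A))
    simp only [mul_assoc]
    rw [← mul_assoc (star (v : A)) v, Unitary.star_mul_self_of_mem v.2, one_mul]
  map_add' b c := by
    ext
    change (v : A) * (b + c) * star (v : A) = v * b * star (v : A) + v * c * star (v : A)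
    rw [mul_add, add_mul]
  map_star' b := by
    ext
    change (v : A) * star (b : A) * star (v : A) = star ((v : A) * b * star (v : A))
    simp only [star_mul, star_star, mul_assoc]
  map_smul' c b := by
    ext
    change (v : A) * (c • (b : A)) * star (v : A) = c • (v * b * star (v : A))
    rw [mul_smul_comm, smul_mul_assoc]

section Predual

variable {v : unitary A} {θ : fixedPoints α ≃⋆ₐ[ℂ] fixedPoints α}

theorem lift_dualAction (hv : ∀ ζ : Circle, α ζ v = (ζ : ℂ) • (v : A))
    (h : ∀ b, (v : A) * (fixedPoints α).subtype b = (fixedPoints α).subtype (θ b) * v)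
    (ζ : Circle) (x : CStarCrossedProduct θ) :
    lift h (dualAction θ ζ x) = α ζ (lift h x) := by
  refine induction_single (P := fun x => lift h (dualAction θ ζ x) = α ζ (lift h x)) x
    (isClosed_eq ((continuous_lift h).comp (continuous_dualMap ζ))
      ((StarAlgEquiv.isometry (α ζ)).continuous.comp (continuous_lift h))) (fun n b => ?_)
    fun y z hy hz => ?_
  · rw [dualAction_ofConv_single, map_smul, lift_ofConv_single, map_mul, apply_zpow hv,
      mul_smul_comm]
    congr 2
    exact (b.2 ζ).symm
  · rw [map_add, map_add, hy, hz, map_add, map_add]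

/-- The `n`-th coefficient of `a`, the `b` with `b v^n` the `n`-th spectral component. -/
noncomputable def coefficient (hα : ∀ a : A, Continuous fun ζ : Circle => α ζ a)
    (hv : ∀ ζ : Circle, α ζ v = (ζ : ℂ) • (v : A)) (n : ℤ) (a : A) : fixedPoints α :=
  ⟨spectralPart α n a * ((v ^ (-n) : unitary A) : A),
    mul_mem_fixedPoints_of_apply_eq_smul (apply_spectralPart hα n a) (apply_zpow hv (-n))⟩

theorem coefficient_add (hα : ∀ a : A, Continuous fun ζ : Circle => α ζ a)
    (hv : ∀ ζ : Circle, α ζ v = (ζ : ℂ) • (v : A)) (n : ℤ) (a b : A) :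
    coefficient hα hv n (a + b) = coefficient hα hv n a + coefficient hα hv n b :=
  Subtype.ext <| by
    change spectralPart α n (a + b) * _ = spectralPart α n a * _ + spectralPart α n b * _
    rw [spectralPart_add hα, add_mul]

theorem coefficient_mul_zpow (hα : ∀ a : A, Continuous fun ζ : Circle => α ζ a)
    (hv : ∀ ζ : Circle, α ζ v = (ζ : ℂ) • (v : A)) (n m : ℤ) (b : fixedPoints α) :
    coefficient hα hv n (b * ((v ^ m : unitary A) : A)) = (Pi.single m 1 : ℤ → ℂ) n • b := by
  ext
  change spectralPart α n (b * ((v ^ m : unitary A) : A)) * ((v ^ (-n) : unitary A) : A) =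
    (Pi.single m 1 : ℤ → ℂ) n • (b : A)
  rw [spectralPart_of_apply_eq (m := m) fun ζ => by
    rw [map_mul, apply_zpow hv, b.2 ζ, mul_smul_comm], smul_mul_assoc]
  obtain rfl | hne := eq_or_ne n m
  · rw [mul_assoc, ← Submonoid.coe_mul, ← zpow_add, add_neg_cancel, zpow_zero, Submonoid.coe_one,
      mul_one]
  · rw [Pi.single_eq_of_ne hne, zero_smul, zero_smul]

theorem continuous_coefficient (hα : ∀ a : A, Continuous fun ζ : Circle => α ζ a)
    (hv : ∀ ζ : Circle, α ζ v = (ζ : ℂ) • (v : A)) (n : ℤ) :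
    Continuous (coefficient hα hv n) :=
  ((continuous_spectralPart hα n).mul continuous_const).subtype_mk _

/-- Shows that the components of x depend only on its image under `lift`. Both sides are continuous
and additive in x, so it suffices to compare them on b vᵐ, where both vanish unless n = m. -/
theorem spectralPart_dualAction (hα : ∀ a : A, Continuous fun ζ : Circle => α ζ a)
    (hv : ∀ ζ : Circle, α ζ v = (ζ : ℂ) • (v : A))
    (h : ∀ b, (v : A) * (fixedPoints α).subtype b = (fixedPoints α).subtype (θ b) * v)
    (n : ℤ) (x : CStarCrossedProduct θ) :
    spectralPart (dualAction θ) n x =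
      ofConv (single (IntAct.of θ n) (coefficient hα hv n (lift h x))) := by
  refine induction_single (P := fun x => spectralPart (dualAction θ) n x =
      ofConv (single (IntAct.of θ n) (coefficient hα hv n (lift h x)))) x
    (isClosed_eq (continuous_spectralPart continuous_dualAction n)
      ((continuous_ofConv_single _).comp
        ((continuous_coefficient hα hv n).comp (continuous_lift h)))) (fun m b => ?_)
    fun y z hy hz => ?_
  · rw [lift_ofConv_single, spectralPart_of_apply_eq fun ζ => dualAction_ofConv_single ζ m b]
    refine Eq.trans ?_ (congrArg _ (congrArg _ (coefficient_mul_zpow hα hv n m.toInt b).symm))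
    by_cases hne : n = m.toInt
    · rw [hne, Pi.single_eq_same, one_smul, one_smul]; rfl
    · rw [Pi.single_eq_of_ne hne, zero_smul, zero_smul, single_zero, ofConv_zero]
  · rw [spectralPart_add continuous_dualAction, hy, hz, map_add, coefficient_add, single_add,
      ofConv_add]

/-- An element of the kernel has zero coefficients, hence zero spectral components, hence lies in
the closed zero subspace. -/
theorem lift_injective (hα : ∀ a : A, Continuous fun ζ : Circle => α ζ a)
    (hv : ∀ ζ : Circle, α ζ v = (ζ : ℂ) • (v : A))
    (h : ∀ b, (v : A) * (fixedPoints α).subtype b = (fixedPoints α).subtype (θ b) * v) :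
    Function.Injective (lift h) := by
  refine (injective_iff_map_eq_zero (lift h)).2 fun x hx => ?_
  have h0 : ∀ n, coefficient hα hv n 0 = 0 := fun n => by
    simpa using coefficient_add hα hv n 0 0
  refine (Submodule.mem_bot ℂ).1 (mem_of_spectralPart_mem (α := dualAction θ) continuous_dualAction
    (S := ⊥) isClosed_singleton fun n => ?_)
  rw [Submodule.mem_bot, spectralPart_dualAction hα hv h, hx, h0,
    single_zero, ofConv_zero]

/-- The range is closed, since an injective ⋆-homomorphism of C⋆-algebras is isometric, and it
contains every spectral component b vⁿ of a. -/
theorem lift_surjective (hα : ∀ a : A, Continuous fun ζ : Circle => α ζ a)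
    (hv : ∀ ζ : Circle, α ζ v = (ζ : ℂ) • (v : A))
    (h : ∀ b, (v : A) * (fixedPoints α).subtype b = (fixedPoints α).subtype (θ b) * v) :
    Function.Surjective (lift h) := by
  intro a
  have hS : IsClosed ((lift h).toAlgHom.toLinearMap.range : Set A) := by
    rw [LinearMap.coe_range]
    exact (NonUnitalStarAlgHom.isometry (lift h)
      (lift_injective hα hv h)).isClosedEmbedding.isClosed_range
  refine mem_of_spectralPart_mem hα hS fun n =>
    ⟨ofConv (single (IntAct.of θ n) (coefficient hα hv n a)), ?_⟩
  refine (lift_ofConv_single h _ _).trans ?_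
  change spectralPart α n a * ((v ^ (-n) : unitary A) : A) * ((v ^ n : unitary A) : A) = _
  rw [mul_assoc, ← Submonoid.coe_mul, ← zpow_add, neg_add_cancel, zpow_zero, Submonoid.coe_one,
    mul_one]

end Predual

/-- The image of the canonical unitary under an equivariant isomorphism. -/
theorem IsPredualIso.exists_unitary {θ : fixedPoints α ≃⋆ₐ[ℂ] fixedPoints α}
    {φ : CStarCrossedProduct θ ≃⋆ₐ[ℂ] A} (hφ : IsPredualIso α θ φ) :
    ∃ v : unitary A, (∀ ζ : Circle, α ζ v = (ζ : ℂ) • (v : A)) ∧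
      ∀ b, (θ b : A) = v * b * star (v : A) := by
  refine ⟨⟨φ (canonicalUnitary θ), Unitary.map_mem φ (canonicalUnitary_mem_unitary θ)⟩,
    fun ζ => ?_, fun b => ?_⟩
  · change α ζ (φ _) = _ • φ _
    rw [← hφ.1, dualAction_canonicalUnitary, map_smul]
  · change _ = φ _ * _ * star (φ _)
    rw [← hφ.2, ← hφ.2, ← map_mul, canonicalUnitary_mul_incl, map_mul, mul_assoc,
      Unitary.mul_star_self_of_mem (Unitary.map_mem φ (canonicalUnitary_mem_unitary θ)), mul_one]

end CircleAction

/-! ### Existence and uniqueness of the predual automorphism -/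

theorem mainTheorem1 {A : Type*} [CStarAlgebra A] (α : Circle →* (A ≃⋆ₐ[ℂ] A))
    (hα : ∀ a : A, Continuous fun ζ : Circle => α ζ a)
    (hR : CircleAction.HasRokhlinProperty α) :
    (∃ (θ : CircleAction.fixedPoints α ≃⋆ₐ[ℂ] CircleAction.fixedPoints α)
        (φ : CStarCrossedProduct θ ≃⋆ₐ[ℂ] A), CircleAction.IsPredualIso α θ φ) ∧
    ∀ (θ θ' : CircleAction.fixedPoints α ≃⋆ₐ[ℂ] CircleAction.fixedPoints α)
      (φ : CStarCrossedProduct θ ≃⋆ₐ[ℂ] A) (φ' : CStarCrossedProduct θ' ≃⋆ₐ[ℂ] A),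
      CircleAction.IsPredualIso α θ φ → CircleAction.IsPredualIso α θ' φ' →
      ∃ w ∈ unitary (CircleAction.fixedPoints α),
        ∀ b : CircleAction.fixedPoints α, θ b = w * θ' b * star w := by
  refine ⟨?_, fun θ θ' φ φ' hφ hφ' => ?_⟩
  · obtain ⟨v, hvu, hv⟩ := hR.exists_unitary_apply_eq_smul hα
    lift v to unitary A using hvu
    have h : ∀ b, (v : A) * (CircleAction.fixedPoints α).subtype b =
        (CircleAction.fixedPoints α).subtype (CircleAction.conjFixedPoints v hv b) * v := by
      intro b
      change (v : A) * b = v * b * star (v : A) * v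
      rw [mul_assoc _ (star (v : A)), Unitary.star_mul_self_of_mem v.2, mul_one]
    refine ⟨CircleAction.conjFixedPoints v hv, StarAlgEquiv.ofBijective (CStarCrossedProduct.lift h)
      ⟨CircleAction.lift_injective hα hv h, CircleAction.lift_surjective hα hv h⟩,
      CircleAction.lift_dualAction hv h, fun b => ?_⟩
    refine (CStarCrossedProduct.lift_ofConv_single h _ b).trans ?_
    change (b : A) * ((v ^ (0 : ℤ) : unitary A) : A) = b
    rw [zpow_zero, Submonoid.coe_one, mul_one]
  · obtain ⟨v, hv, hθ⟩ := hφ.exists_unitary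
    obtain ⟨v', hv', hθ'⟩ := hφ'.exists_unitary
    -- The weights 1 and -1 cancel, so this is the unitary w of the conclusion.
    have hw : (v : A) * star (v' : A) ∈ CircleAction.fixedPoints α :=
      CircleAction.mul_mem_fixedPoints_of_apply_eq_smul (n := 1) (fun ζ => by simpa using hv ζ)
        (CircleAction.apply_star hv')
    have hu : (v : A) * star (v' : A) ∈ unitary A := (v * star v').2
    refine ⟨⟨_, hw⟩, Unitary.mem_iff.2 ⟨Subtype.ext (Unitary.star_mul_self_of_mem hu),
      Subtype.ext (Unitary.mul_star_self_of_mem hu)⟩, fun b => Subtype.ext ?_⟩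
    change (θ b : A) = v * star (v' : A) * θ' b * star (v * star (v' : A))
    rw [hθ, hθ', star_mul, star_star]
    -- Cancelling v'⋆v' twice reduces w (v' b v'⋆) w⋆ to v b v⋆.
    have e : ∀ x : A, star (v' : A) * (v' * x) = x := fun x => by
      rw [← mul_assoc, Unitary.star_mul_self_of_mem v'.2, one_mul]
    simp only [mul_assoc, e]
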